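/- Let $q$ be a prime power, $G=\mathrm{GL}_2(\mathbb{F}_q)$, and view $G$ as the diagonal subgroup $\mathrm{diag}(G)$ of $G\times G$. For a finite-dimensional complex representation $\pi\colon G\to \mathrm{GL}(W)$ let $E(\pi)$ be the space of spherical functions of type $\pi$, i.e. of functions $\Psi\colon G\times G\to \mathrm{End}(W)$ with $\Psi(h_1xh_2)=\pi(h_1)\Psi(x)\pi(h_2)$ for all $h_1,h_2\in\mathrm{diag}(G)$, $x\in G\times G$. For the trivial representation $U_0$ this is the algebra $E(U_0)$ of $\mathrm{diag}(G)$-biinvariant complex functions on $G\times G$ (the zonal spherical functions) under pointwise multiplication, and every $E(\pi)$ is an $E(U_0)$-module under pointwise multiplication. Fix a generator $\sigma$ of $\mathbb{F}_{q^2}^\times$, let $n'$ be an integer not divisible by $q+1$, and let $\phi_{n'}\colon\mathbb{F}_{q^2}^\times\to\mathbb{C}^\times$ be the character with $\phi_{n'}(\sigma)=\exp(2\pi i n'/(q^2-1))$. Let $X_{[n']}$ be the irreducible complex representation of $G$ of dimension $q-1$ whose character takes the value $(q-1)\phi_{n'}(a)$ at the scalar matrix $a\in\mathbb{F}_q^\times$,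 $-\phi_{n'}(a)$ at $\begin{pmatrix}a&0\\1&a\end{pmatrix}$, $0$ at $\mathrm{diag}(a,b)$ with $a\neq b$ in $\mathbb{F}_q^\times$, and $-(\phi_{n'}(z)+\phi_{n'}(z^q))$ at an element with eigenvalues $z,z^q$, $z\in\mathbb{F}_{q^2}\setminus\mathbb{F}_q$. Then $$\dim_{\mathbb{C}}E(X_{[n']})=(q-1)(q^2-q+1),\qquad \dim_{\mathbb{C}}E(U_0)=q^2-1 .$$ If moreover $q\neq 2$, then $\dim E(U_0)$ does not divide $\dim E(X_{[n']})$, and $E(X_{[n']})$ is not a free $E(U_0)$-module. -/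

import Mathlib

open scoped Matrix

noncomputable section

/-- The algebra `E(π₁)` of zonal spherical functions of a pair `H ≤ G`: the `H`-biinvariant
complex functions on `G`, with pointwise multiplication. -/
def zonalAlgebra {G : Type*} [Group G] (H : Subgroup G) : Subalgebra ℂ (G → ℂ) where
  carrier := {f | ∀ (h₁ h₂ : H) (x : G), f (h₁ * x * h₂) = f x}
  mul_mem' {a b} ha hb := fun h₁ h₂ x => by simp only [Pi.mul_apply, ha h₁ h₂ x, hb h₁ h₂ x]
  add_mem' {a b} ha hb := fun h₁ h₂ x => by simp only [Pi.add_apply, ha h₁ h₂ x, hb h₁ h₂ x]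
  algebraMap_mem' _ := fun _ _ _ => rfl

/-- The space `E(π)` of spherical functions of type `π`: the functions `Ψ : G → End(W)` with
`Ψ(h₁ x h₂) = π(h₁) Ψ(x) π(h₂)` for all `h₁, h₂ ∈ H` and `x ∈ G`, as a module over the algebra of
zonal spherical functions under pointwise multiplication. -/
def sphericalFunctions {G : Type*} [Group G] (H : Subgroup G) {W : Type*} [AddCommGroup W]
    [Module ℂ W] (π : Representation ℂ H W) :
    Submodule (zonalAlgebra H) (G → Module.End ℂ W) where
  carrier := {Ψ | ∀ (h₁ h₂ : H) (x : G), Ψ (h₁ * x * h₂) = π h₁ * Ψ x * π h₂}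
  add_mem' {a b} ha hb := fun h₁ h₂ x => by
    simp only [Pi.add_apply, ha h₁ h₂ x, hb h₁ h₂ x, mul_add, add_mul]
  zero_mem' := fun h₁ h₂ x => by simp
  smul_mem' c Ψ hΨ := fun h₁ h₂ x => by
    change (c : G → ℂ) (h₁ * x * h₂) • Ψ (h₁ * x * h₂) = π h₁ * ((c : G → ℂ) x • Ψ x) * π h₂
    rw [c.2 h₁ h₂ x, hΨ h₁ h₂ x, mul_smul_comm, smul_mul_assoc]

/-- The zonal spherical functions are the spherical functions of trivial type, under the
identification of `ℂ` with `End(ℂ)`. -/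
theorem mem_zonalAlgebra_iff {G : Type*} [Group G] (H : Subgroup G) (f : G → ℂ) :
    f ∈ zonalAlgebra H ↔
      (fun x => algebraMap ℂ (Module.End ℂ ℂ) (f x)) ∈
        sphericalFunctions H (Representation.trivial ℂ H ℂ) := by
  have key : ∀ x y : G, (algebraMap ℂ (Module.End ℂ ℂ) (f x) = algebraMap ℂ (Module.End ℂ ℂ) (f y))
      ↔ f x = f y := fun x y => (FaithfulSMul.algebraMap_injective ℂ (Module.End ℂ ℂ)).eq_iff
  have one : ∀ h : H, Representation.trivial ℂ H ℂ h = 1 := fun _ => rfl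
  constructor
  · intro hf h₁ h₂ x
    simp only [one, one_mul, mul_one]
    exact (key _ _).2 (hf h₁ h₂ x)
  · intro hf h₁ h₂ x
    have h := hf h₁ h₂ x
    simp only [one, one_mul, mul_one] at h
    exact (key _ _).1 h

/-- The diagonal subgroup `diag(G)` of `G × G`. -/
def diagSubgroup (G : Type*) [Group G] : Subgroup (G × G) :=
  ((MonoidHom.id G).prod (MonoidHom.id G)).range

/-- A representation of `G` viewed as a representation of `diag(G)`. -/
def diagRep {G : Type*} [Group G] {W : Type*} [AddCommGroup W] [Module ℂ W]
    (π : Representation ℂ G W) : Representation ℂ (diagSubgroup G) W :=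
  π.comp ((MonoidHom.fst G G).comp (diagSubgroup G).subtype)

/-- The character `φ_n` of the cyclic group `Kˣ` of a finite field `K` determined by
`φ_n(σ) = exp(2 π i n / |Kˣ|)`, where `σ` is a generator of `Kˣ`. -/
def fieldChar {K : Type*} [Field K] [Finite K] (σ : Kˣ) (hσ : ∀ x : Kˣ, x ∈ Subgroup.zpowers σ)
    (n : ℤ) : Kˣ →* ℂˣ :=
  monoidHomOfForallMemZpowers hσ
    (g' := Units.mk0 (Complex.exp (2 * Real.pi * Complex.I * n / Nat.card Kˣ))
      (Complex.exp_ne_zero _)) (by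
    rw [orderOf_eq_card_of_forall_mem_zpowers hσ]
    apply orderOf_dvd_of_pow_eq_one
    ext
    have h0 : (Nat.card Kˣ : ℂ) ≠ 0 := Nat.cast_ne_zero.2 Nat.card_pos.ne'
    simp only [Units.val_pow_eq_pow_val, Units.val_mk0, Units.val_one, ← Complex.exp_nat_mul]
    rw [mul_div_cancel₀ _ h0, Complex.exp_eq_one_iff]
    exact ⟨n, by ring⟩)

/-- The invertible matrix with rows `(a, 0)` and `(c, b)`. -/
def lowerGL {L : Type*} [Field L] (a b : Lˣ) (c : L) : GL (Fin 2) L :=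
  Matrix.GeneralLinearGroup.mkOfDetNeZero !![(a : L), 0; c, (b : L)] (by
    simp [Matrix.det_fin_two_of])

/-- For a finite field `F` with `q` elements, a quadratic extension `K` of `F` and a generator
`σ` of `Kˣ`: the representation `π` of `GL₂(F)` is irreducible and belongs to the equivalence class
`X_[n]` (with `n` not divisible by `q + 1`), that is, its character takes the values
* `(q - 1) φ_n(a)` at the scalar matrix `a`,
* `-φ_n(a)` at the non-semisimple matrix with double eigenvalue `a ∈ Fˣ`,
* `0` at `diag(a, b)` with `a ≠ b` in `Fˣ`,
* `-(φ_n(z) + φ_n(z ^ q))` at a matrix that is conjugate, over `K`, to `diag(z, z ^ q)` with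
  `z` in `K` but not in `F`. -/
structure IsTypeX {F K : Type*} [Field F] [Finite F] [Field K] [Finite K] [Algebra F K]
    (σ : Kˣ) (hσ : ∀ x : Kˣ, x ∈ Subgroup.zpowers σ) (n : ℤ)
    {W : Type*} [AddCommGroup W] [Module ℂ W] (π : Representation ℂ (GL (Fin 2) F) W) : Prop where
  index : ¬ ((Nat.card F : ℤ) + 1 ∣ n)
  irreducible : π.IsIrreducible
  scalar : ∀ a : Fˣ, π.character (lowerGL a a 0) =
    ((Nat.card F : ℂ) - 1) * fieldChar σ hσ n (Units.map (algebraMap F K).toMonoidHom a)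
  unipotent : ∀ a : Fˣ, π.character (lowerGL a a 1) =
    -fieldChar σ hσ n (Units.map (algebraMap F K).toMonoidHom a)
  split : ∀ a b : Fˣ, a ≠ b → π.character (lowerGL a b 0) = 0
  nonsplit : ∀ (g : GL (Fin 2) F) (z : Kˣ), (z : K) ∉ (algebraMap F K).range →
    IsConj (Matrix.GeneralLinearGroup.map (algebraMap F K) g) (lowerGL z (z ^ Nat.card F) 0) →
    π.character g = -(fieldChar σ hσ n z + fieldChar σ hσ n (z ^ Nat.card F))

end

/-! A function `Ψ` on `G × G` that transforms under the diagonal on both sides is determined by `g ↦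
Ψ(1, g)`, and what remains of its equivariance is compatibility with conjugation. Hence `E(U₀)` is
the space of class functions, and `E(π)` is the space of intertwiners from the conjugation
representation on `ℂ[G]` to `End(W)`. The character of `ℂ[G]` at `g` is the order of the centralizer
of `g`, so orbit-stabilizer turns the character formula for the dimension into the unnormalized sum
of `χ(g)χ(g⁻¹)` over conjugacy classes (`finrank_sphericalFunctions_diagSubgroup`).

In `GL₂(F)` a class is a scalar or a pair (trace, determinant) with nonzero determinant
(`conjClassesGL2Equiv`), which gives `(q-1) + q(q-1) = q²-1` classes. For `X_[n]` the scalars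
contribute `(q-1)³`, double roots `q-1`, distinct roots in `F` nothing, and irreducible polynomials
`(q-1)²`. The last value is half of a sum over `K ∖ F` (`two_mul_sum_quadratic`), evaluated by
orthogonality of characters of `Kˣ` (`sum_nonsplit`). The total is `(q-1)(q²-q+1)`. Divisibility by
`q²-1` would force `q+1 ∣ 3`, and freeness would force divisibility. -/

/-- The permutation representation of a group on the finitely supported functions on itself,
given by conjugation. -/
noncomputable def conjPermRep (G : Type*) [Group G] : Representation ℂ G (G →₀ ℂ) where
  toFun g := Finsupp.lmapDomain ℂ ℂ (fun x => g * x * g⁻¹)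
  map_one' := by
    ext x : 1
    simp [LinearMap.ext_iff]
  map_mul' g h := by
    ext x : 1
    simp [LinearMap.ext_iff, mul_assoc]

/-! ### The conjugation representation and weighted Burnside counting -/

theorem conjPermRep_single {G : Type*} [Group G] (g x : G) (c : ℂ) :
    conjPermRep G g (Finsupp.single x c) = Finsupp.single (g * x * g⁻¹) c := by
  simp [conjPermRep]

/-- The trace of a permutation matrix counts fixed points, here the elements commuting with `g`. -/
theorem character_conjPermRep {G : Type*} [Group G] [Fintype G] (g : G) :
    (conjPermRep G).character g = (Nat.card {x : G // g * x * g⁻¹ = x} : ℂ) := by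
  classical
  rw [Representation.character, LinearMap.trace_eq_matrix_trace ℂ Finsupp.basisSingleOne,
    Matrix.trace, Nat.card_eq_fintype_card, Fintype.card_subtype]
  simp [LinearMap.toMatrix_apply, conjPermRep_single, Finsupp.single_apply]

/-- Burnside's counting argument with a weight that is constant on conjugacy classes. -/
theorem sum_card_commute_mul {G : Type*} [Group G] [Fintype G] [Fintype (ConjClasses G)]
    (f : ConjClasses G → ℂ) :
    ∑ g : G, (Nat.card {x : G // g * x * g⁻¹ = x} : ℂ) * f (ConjClasses.mk g) =
      Nat.card G * ∑ c, f c := by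
  classical
  rw [← Finset.sum_fiberwise (s := Finset.univ) (g := (ConjClasses.mk : G → ConjClasses G)),
    Finset.mul_sum]
  refine Finset.sum_congr rfl fun c _ => ?_
  obtain ⟨g₀, rfl⟩ := ConjClasses.exists_rep c
  -- Orbit-stabilizer: centralizer order times class size is `|G|`, so each class `c` contributes
  -- exactly `|G| f(c)`.
  have hcard : ∀ g : G, Nat.card {x : G // g * x * g⁻¹ = x} *
      Nat.card (MulAction.orbit (ConjAct G) g) = Nat.card G := by
    intro g
    have h := MulAction.card_orbit_mul_card_stabilizer_eq_card_group (ConjAct G) g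
    have e : {x : G // g * x * g⁻¹ = x} ≃ MulAction.stabilizer (ConjAct G) g :=
      ConjAct.toConjAct.toEquiv.subtypeEquiv fun x => by
        simp only [MulAction.mem_stabilizer_iff, MulEquiv.toEquiv_eq_coe, EquivLike.coe_coe,
          ConjAct.smul_def, ConjAct.ofConjAct_toConjAct, mul_inv_eq_iff_eq_mul]
        exact eq_comm
    rw [Nat.card_congr e, mul_comm, Nat.card_eq_fintype_card, Nat.card_eq_fintype_card, h,
      Nat.card_eq_fintype_card]
    exact (Fintype.card_congr ConjAct.toConjAct.toEquiv).symm
  have horb : ∀ g : G, ConjClasses.mk g = ConjClasses.mk g₀ →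
      Nat.card (MulAction.orbit (ConjAct G) g) = Nat.card (MulAction.orbit (ConjAct G) g₀) := by
    intro g hg
    rw [ConjClasses.mk_eq_mk_iff_isConj, isConj_comm, ← ConjAct.orbitRel_conjAct,
      MulAction.orbitRel_apply] at hg
    rw [MulAction.orbit_eq_iff.2 (by simpa using MulAction.mem_orbit_symm.1 hg)]
  have hfib : (Finset.univ.filter fun g : G => ConjClasses.mk g = ConjClasses.mk g₀).card =
      Nat.card (MulAction.orbit (ConjAct G) g₀) := by
    rw [← Fintype.card_subtype, ← Nat.card_eq_fintype_card]
    refine Nat.card_congr (Equiv.subtypeEquivRight fun g => ?_)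
    rw [ConjClasses.mk_eq_mk_iff_isConj, ← ConjAct.orbitRel_conjAct, MulAction.orbitRel_apply]
  have hpos : (Nat.card (MulAction.orbit (ConjAct G) g₀) : ℂ) ≠ 0 := by
    intro h0
    have := hcard g₀
    rw [Nat.cast_eq_zero.1 h0, mul_zero] at this
    exact Nat.card_pos.ne this
  calc _ = ∑ g with ConjClasses.mk g = ConjClasses.mk g₀,
        (Nat.card {x : G // g₀ * x * g₀⁻¹ = x} : ℂ) * f (ConjClasses.mk g₀) := by
        refine Finset.sum_congr rfl fun g hg => ?_
        have hg' := (Finset.mem_filter.1 hg).2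
        rw [hg']
        congr 1
        refine mul_right_cancel₀ hpos ?_
        rw [← Nat.cast_mul, ← Nat.cast_mul, hcard, ← horb g hg', hcard]
    _ = _ := by
        rw [Finset.sum_const, hfib, nsmul_eq_mul, ← mul_assoc, mul_comm (Nat.cast _),
          ← Nat.cast_mul, hcard]

/-! ### Spherical functions for the diagonal subgroup -/

section Diagonal

variable {G : Type*} [Group G]

theorem mem_zonalAlgebra_diagSubgroup {f : G × G → ℂ} :
    f ∈ zonalAlgebra (diagSubgroup G) ↔
      ∀ a b x y : G, f (a * x * b, a * y * b) = f (x, y) := by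
  constructor
  · intro h a b x y
    exact h ⟨(a, a), a, rfl⟩ ⟨(b, b), b, rfl⟩ (x, y)
  · rintro h ⟨_, a, rfl⟩ ⟨_, b, rfl⟩ ⟨x, y⟩
    exact h a b x y

theorem mem_sphericalFunctions_diagSubgroup {W : Type*} [AddCommGroup W] [Module ℂ W]
    {π : Representation ℂ G W} {Ψ : G × G → Module.End ℂ W} :
    Ψ ∈ sphericalFunctions (diagSubgroup G) (diagRep π) ↔
      ∀ a b x y : G, Ψ (a * x * b, a * y * b) = π a * Ψ (x, y) * π b := by
  constructor
  · intro h a b x y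
    exact h ⟨(a, a), a, rfl⟩ ⟨(b, b), b, rfl⟩ (x, y)
  · rintro h ⟨_, a, rfl⟩ ⟨_, b, rfl⟩ ⟨x, y⟩
    exact h a b x y

/-- The zonal spherical functions of `diag(G)` in `G × G` are the class functions on `G`. -/
noncomputable def zonalAlgebraDiagEquiv :
    zonalAlgebra (diagSubgroup G) ≃ₗ[ℂ] (ConjClasses G → ℂ) where
  toFun f := Quotient.lift (fun g : G => (f : G × G → ℂ) (1, g)) (by
    rintro a b hab
    obtain ⟨c, rfl⟩ := isConj_iff.1 hab
    simpa using (mem_zonalAlgebra_diagSubgroup.1 f.2 c c⁻¹ 1 a).symm)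
  map_add' f g := by
    ext c
    obtain ⟨x, rfl⟩ := ConjClasses.exists_rep c
    rfl
  map_smul' r f := by
    ext c
    obtain ⟨x, rfl⟩ := ConjClasses.exists_rep c
    rfl
  invFun φ := ⟨fun p => φ (ConjClasses.mk (p.1⁻¹ * p.2)), mem_zonalAlgebra_diagSubgroup.2 <| by
    intro a b x y
    congr 1
    rw [ConjClasses.mk_eq_mk_iff_isConj, isConj_iff]
    exact ⟨b, by group⟩⟩
  left_inv f := by
    ext ⟨x, y⟩
    change (f : G × G → ℂ) (1, x⁻¹ * y) = _
    simpa using (mem_zonalAlgebra_diagSubgroup.1 f.2 x 1 1 (x⁻¹ * y)).symm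
  right_inv φ := by
    ext c
    obtain ⟨x, rfl⟩ := ConjClasses.exists_rep c
    change φ (ConjClasses.mk (1⁻¹ * x)) = _
    simp

theorem finrank_zonalAlgebra_diagSubgroup [Finite G] :
    Module.finrank ℂ (zonalAlgebra (diagSubgroup G)) = Nat.card (ConjClasses G) := by
  have : Fintype (ConjClasses G) := Fintype.ofFinite _
  rw [zonalAlgebraDiagEquiv.finrank_eq, Module.finrank_pi, Nat.card_eq_fintype_card]

/-- The spherical functions of type `π` for `diag(G)` in `G × G` are the intertwining maps from
the conjugation representation to `End(W)`. -/
noncomputable def sphericalFunctionsDiagEquiv {W : Type*} [AddCommGroup W] [Module ℂ W]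
    (π : Representation ℂ G W) :
    (conjPermRep G).IntertwiningMap (Representation.linHom π π) ≃ₗ[ℂ]
      sphericalFunctions (diagSubgroup G) (diagRep π) where
  -- Left equivariance forces `Ψ(x, y) = π(x) Ψ(1, x⁻¹y)`.
  toFun f := ⟨fun p => π p.1 * f (Finsupp.single (p.1⁻¹ * p.2) 1),
    mem_sphericalFunctions_diagSubgroup.2 <| by
      intro a b x y
      have h := f.isIntertwining _ _ b⁻¹ (Finsupp.single (x⁻¹ * y) 1)
      rw [conjPermRep_single, Representation.linHom_apply] at h
      have e : (a * x * b)⁻¹ * (a * y * b) = b⁻¹ * (x⁻¹ * y) * b⁻¹⁻¹ := by group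
      simp only [e, h]
      simp only [map_mul, inv_inv, ← Module.End.mul_eq_comp, mul_assoc]
      rw [← mul_assoc (π b) (π b⁻¹), ← map_mul π b b⁻¹, mul_inv_cancel b, map_one, one_mul]⟩
  map_add' f g := by
    ext p : 2
    simp [mul_add]
  map_smul' r f := by
    ext p : 2
    exact mul_smul_comm r _ _
  invFun Ψ :=
    { toLinearMap := Finsupp.lift (Module.End ℂ W) ℂ G
        (fun g => (Ψ : G × G → Module.End ℂ W) (1, g))
      isIntertwining' := by
        intro g
        ext x : 1
        ext : 1
        have h := mem_sphericalFunctions_diagSubgroup.1 Ψ.2 g g⁻¹ 1 x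
        simpa [conjPermRep_single, Representation.linHom_apply, Module.End.mul_eq_comp,
          LinearMap.comp_assoc] using h }
  left_inv f := by
    ext x : 3
    simp
  right_inv Ψ := by
    ext ⟨x, y⟩ : 2
    have h := mem_sphericalFunctions_diagSubgroup.1 Ψ.2 x 1 1 (x⁻¹ * y)
    simpa using h.symm

/-- The dimension of the intertwiner space is an average over `G` in which the centralizer order
weights `χ(g)χ(g⁻¹)`. Descending this product to a function `f` on classes makes
`sum_card_commute_mul` applicable. -/
theorem finrank_sphericalFunctions_diagSubgroup [Fintype G] [Fintype (ConjClasses G)]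
    {W : Type*} [AddCommGroup W] [Module ℂ W] [FiniteDimensional ℂ W]
    (π : Representation ℂ G W) (f : ConjClasses G → ℂ)
    (hf : ∀ g, f (ConjClasses.mk g) = π.character g * π.character g⁻¹) :
    (Module.finrank ℂ (sphericalFunctions (diagSubgroup G) (diagRep π)) : ℂ) = ∑ c, f c := by
  have hG : (Nat.card G : ℂ) ≠ 0 := Nat.cast_ne_zero.2 Nat.card_pos.ne'
  have : Invertible (Nat.card G : ℂ) := invertibleOfNonzero hG
  rw [← (sphericalFunctionsDiagEquiv π).finrank_eq,
    ← Representation.card_inv_mul_sum_char_mul_char_eq_finrank,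
    inv_mul_eq_iff_eq_mul₀ hG, ← sum_card_commute_mul]
  refine Finset.sum_congr rfl fun g _ => ?_
  rw [Representation.char_linHom, character_conjPermRep, hf, mul_comm, mul_comm (π.character _)]
  congr 2
  -- An element and its inverse have the same centralizer.
  refine Nat.card_congr (Equiv.subtypeEquivRight fun x => ?_)
  constructor <;> intro h <;> [nth_rw 1 [← h]; nth_rw 1 [← h]] <;> group

end Diagonal

/-! ### Conjugacy classes of `GL₂` over a field -/

/-- The companion matrix with trace `t` and determinant `d`. -/
noncomputable def companionGL {L : Type*} [Field L] (t : L) (d : Lˣ) : GL (Fin 2) L :=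
  Matrix.GeneralLinearGroup.mkOfDetNeZero !![0, -(d : L); 1, t] (by
    simp [Matrix.det_fin_two_of])

section GL2

variable {L : Type*} [Field L]

theorem coe_lowerGL (a b : Lˣ) (c : L) :
    (lowerGL a b c : Matrix (Fin 2) (Fin 2) L) = !![(a : L), 0; c, (b : L)] := rfl

theorem coe_companionGL (t : L) (d : Lˣ) :
    (companionGL t d : Matrix (Fin 2) (Fin 2) L) = !![0, -(d : L); 1, t] := rfl

theorem trace_eq_of_isConj {g h : GL (Fin 2) L} (H : IsConj g h) :
    (g : Matrix (Fin 2) (Fin 2) L).trace = (h : Matrix (Fin 2) (Fin 2) L).trace := by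
  obtain ⟨c, rfl⟩ := isConj_iff.1 H
  rw [Units.val_mul, Units.val_mul, Matrix.trace_mul_cycle, ← Units.val_mul, inv_mul_cancel,
    Units.val_one, one_mul]

theorem det_eq_of_isConj {g h : GL (Fin 2) L} (H : IsConj g h) :
    Matrix.GeneralLinearGroup.det g = Matrix.GeneralLinearGroup.det h := by
  obtain ⟨c, rfl⟩ := isConj_iff.1 H
  rw [map_mul, map_mul, mul_comm, ← mul_assoc, ← map_mul, inv_mul_cancel, map_one, one_mul]

/-- A matrix in `GL₂(L)` that is not scalar is conjugate to a companion matrix. -/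
theorem isConj_companionGL (g : GL (Fin 2) L) (hg : ∀ a : Lˣ, g ≠ lowerGL a a 0) :
    IsConj (companionGL (g : Matrix (Fin 2) (Fin 2) L).trace
      (Matrix.GeneralLinearGroup.det g)) g := by
  -- The expression is `det(v, gv)` for `v = (x, y)`. If it always vanished, every vector would be
  -- an eigenvector; testing `(1,0)`, `(0,1)` and `(1,1)` shows that `g` would be scalar.
  obtain ⟨x, y, hxy⟩ : ∃ x y : L, x * (g 1 0 * x + g 1 1 * y) - (g 0 0 * x + g 0 1 * y) * y ≠ 0 := by
    by_contra! H
    have h10 : g 1 0 = 0 := by simpa using H 1 0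
    have h01 : g 0 1 = 0 := by simpa using H 0 1
    have h11 : g 1 1 = g 0 0 := by simpa [h10, h01, sub_eq_zero] using H 1 1
    have hne : g 0 0 ≠ 0 := by
      intro h0
      apply (Matrix.GeneralLinearGroup.det g).ne_zero
      rw [Matrix.GeneralLinearGroup.val_det_apply, Matrix.det_fin_two, h10, h01, h11, h0]
      simp
    apply hg (Units.mk0 _ hne)
    ext i j
    fin_cases i <;> fin_cases j <;> simp [coe_lowerGL, h10, h01, h11]
  -- The columns of `P` are `v` and `gv`; by Cayley–Hamilton, `g` is a companion matrix in this
  -- basis.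
  let P : GL (Fin 2) L := Matrix.GeneralLinearGroup.mkOfDetNeZero
    !![x, g 0 0 * x + g 0 1 * y; y, g 1 0 * x + g 1 1 * y] (by
      rwa [Matrix.det_fin_two_of])
  have hP : (P : Matrix (Fin 2) (Fin 2) L) =
    !![x, g 0 0 * x + g 0 1 * y; y, g 1 0 * x + g 1 1 * y] := rfl
  refine isConj_iff.2 ⟨P, ?_⟩
  rw [mul_inv_eq_iff_eq_mul]
  apply Units.ext
  rw [Units.val_mul, Units.val_mul, hP, coe_companionGL, Matrix.GeneralLinearGroup.val_det_apply,
    Matrix.det_fin_two, Matrix.trace_fin_two]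
  ext i j
  fin_cases i <;> fin_cases j <;> simp [Matrix.mul_apply, Fin.sum_univ_two] <;> ring

theorem trace_companionGL (t : L) (d : Lˣ) :
    (companionGL t d : Matrix (Fin 2) (Fin 2) L).trace = t := by
  simp [coe_companionGL, Matrix.trace_fin_two]

theorem det_companionGL (t : L) (d : Lˣ) :
    Matrix.GeneralLinearGroup.det (companionGL t d) = d := by
  ext
  simp [coe_companionGL, Matrix.det_fin_two]

theorem trace_lowerGL (a b : Lˣ) (c : L) :
    (lowerGL a b c : Matrix (Fin 2) (Fin 2) L).trace = a + b := by
  simp [coe_lowerGL, Matrix.trace_fin_two]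

theorem det_lowerGL (a b : Lˣ) (c : L) :
    Matrix.GeneralLinearGroup.det (lowerGL a b c) = a * b := by
  ext
  simp [coe_lowerGL, Matrix.det_fin_two]

theorem conj_lowerGL_scalar (a : Lˣ) (g : GL (Fin 2) L) :
    g * lowerGL a a 0 * g⁻¹ = lowerGL a a 0 := by
  rw [mul_inv_eq_iff_eq_mul]
  ext i j
  fin_cases i <;> fin_cases j <;> simp [Matrix.mul_apply, Fin.sum_univ_two, coe_lowerGL, mul_comm]

theorem isConj_lowerGL_scalar_iff {a : Lˣ} {g : GL (Fin 2) L} :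
    IsConj (lowerGL a a 0) g ↔ g = lowerGL a a 0 := by
  constructor
  · intro h
    obtain ⟨c, rfl⟩ := isConj_iff.1 h
    exact conj_lowerGL_scalar a c
  · rintro rfl
    exact IsConj.refl _

theorem companionGL_ne_scalar (t : L) (d a : Lˣ) : companionGL t d ≠ lowerGL a a 0 := by
  intro h
  have : (companionGL t d : Matrix (Fin 2) (Fin 2) L) 1 0 = (lowerGL a a 0 : GL (Fin 2) L) 1 0 := by
    rw [h]
  simp [coe_companionGL, coe_lowerGL] at this

theorem isConj_companionGL_lowerGL (a b : Lˣ) (c : L) (h : a ≠ b ∨ c ≠ 0) :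
    IsConj (companionGL (a + b : L) (a * b)) (lowerGL a b c) := by
  have := isConj_companionGL (lowerGL a b c) (by
    intro e he
    have h00 : (lowerGL a b c) 0 0 = (lowerGL e e 0) 0 0 := by rw [he]
    have h11 : (lowerGL a b c) 1 1 = (lowerGL e e 0) 1 1 := by rw [he]
    have h10 : (lowerGL a b c) 1 0 = (lowerGL e e 0) 1 0 := by rw [he]
    simp only [coe_lowerGL, Matrix.of_apply, Matrix.cons_val', Matrix.cons_val_zero,
      Matrix.cons_val_one, Matrix.cons_val_fin_one, Units.val_inj] at h00 h11 h10
    rcases h with h | h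
    · exact h (h00.trans h11.symm)
    · exact h h10)
  rwa [trace_lowerGL, det_lowerGL] at this

/-- The conjugacy classes of `GL₂(L)` are those of the scalar matrices and those of the companion
matrices. -/
noncomputable def conjClassesGL2Equiv : Lˣ ⊕ (L × Lˣ) ≃ ConjClasses (GL (Fin 2) L) :=
  Equiv.ofBijective
    (Sum.elim (fun a => ConjClasses.mk (lowerGL a a 0))
      (fun p => ConjClasses.mk (companionGL p.1 p.2))) (by
    constructor
    · rintro (a | ⟨t, d⟩) (b | ⟨t', d'⟩) h <;>
        simp only [Sum.elim_inl, Sum.elim_inr, ConjClasses.mk_eq_mk_iff_isConj] at h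
      · rw [isConj_lowerGL_scalar_iff] at h
        have : (lowerGL b b 0 : GL (Fin 2) L) 0 0 = (lowerGL a a 0 : GL (Fin 2) L) 0 0 := by rw [h]
        simp only [coe_lowerGL, Matrix.of_apply, Matrix.cons_val', Matrix.cons_val_zero,
          Matrix.cons_val_fin_one, Units.val_inj] at this
        rw [this]
      · exact absurd (isConj_lowerGL_scalar_iff.1 h) (companionGL_ne_scalar _ _ _)
      · exact absurd (isConj_lowerGL_scalar_iff.1 h.symm) (companionGL_ne_scalar _ _ _)
      · have ht := trace_eq_of_isConj h
        have hd := det_eq_of_isConj h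
        rw [trace_companionGL, trace_companionGL] at ht
        rw [det_companionGL, det_companionGL] at hd
        rw [ht, hd]
    · intro c
      obtain ⟨g, rfl⟩ := ConjClasses.exists_rep c
      by_cases hg : ∃ a : Lˣ, g = lowerGL a a 0
      · obtain ⟨a, rfl⟩ := hg
        exact ⟨Sum.inl a, rfl⟩
      · push Not at hg
        exact ⟨Sum.inr (_, _), ConjClasses.mk_eq_mk_iff_isConj.2 (isConj_companionGL g hg)⟩)

end GL2

/-! ### Frobenius, quadratic polynomials and character sums in `K/F` -/

section QuadraticExtension

variable {F K : Type*} [Field F] [Field K] [Algebra F K]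

/-- The Galois group consists of powers of Frobenius, so being fixed by Frobenius means lying in the
base field. -/
theorem pow_natCard_eq_self_iff [Finite F] [Finite K] (x : K) :
    x ^ Nat.card F = x ↔ x ∈ (algebraMap F K).range := by
  have := Fintype.ofFinite F
  have : Module.Finite F K := Module.Finite.of_finite
  rw [Nat.card_eq_fintype_card]
  constructor
  · intro h
    refine (IsGalois.mem_range_algebraMap_iff_fixed x).2 fun s => ?_
    obtain ⟨n, rfl⟩ := (FiniteField.bijective_frobeniusAlgEquivOfAlgebraic_pow F K).2 s
    dsimp only
    rw [AlgEquiv.coe_pow]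
    exact Function.iterate_fixed h _
  · rintro ⟨a, rfl⟩
    rw [← map_pow, FiniteField.pow_card]

theorem pow_natCard_sq [Finite K] (hK : Module.finrank F K = 2) (x : K) :
    (x ^ Nat.card F) ^ Nat.card F = x := by
  have := Fintype.ofFinite K
  have h : Nat.card K = Nat.card F ^ 2 := by rw [Module.natCard_eq_pow_finrank (K := F), hK]
  rw [← pow_mul, ← sq, ← h, Nat.card_eq_fintype_card, FiniteField.pow_card]

theorem add_pow_natCard [Finite F] (x y : K) :
    (x + y) ^ Nat.card F = x ^ Nat.card F + y ^ Nat.card F := by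
  have := Fintype.ofFinite F
  rw [Nat.card_eq_fintype_card]
  exact map_add (FiniteField.frobeniusAlgHom F K) x y

theorem exists_trace [Finite F] [Finite K] (hK : Module.finrank F K = 2) (z : K) :
    ∃ t : F, algebraMap F K t = z + z ^ Nat.card F :=
  (pow_natCard_eq_self_iff _).1 (by rw [add_pow_natCard, pow_natCard_sq hK, add_comm])

theorem exists_norm [Finite F] [Finite K] (hK : Module.finrank F K = 2) (z : Kˣ) :
    ∃ d : Fˣ, algebraMap F K d = z * z ^ Nat.card F := by
  obtain ⟨d, hd⟩ := (pow_natCard_eq_self_iff (F := F) ((z : K) * z ^ Nat.card F)).1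
    (by rw [mul_pow, pow_natCard_sq hK, mul_comm])
  refine ⟨Units.mk0 d ?_, hd⟩
  rintro rfl
  rw [map_zero] at hd
  exact mul_ne_zero z.ne_zero (pow_ne_zero _ z.ne_zero) hd.symm

open Polynomial in
/-- A quadratic polynomial over `F` has a root in a quadratic extension. -/
theorem exists_root_quadratic [Finite K] (hK : Module.finrank F K = 2) (t d : F) :
    ∃ z : K, z ^ 2 - algebraMap F K t * z + algebraMap F K d = 0 := by
  by_cases hr : ∃ a : F, a ^ 2 - t * a + d = 0
  · obtain ⟨a, ha⟩ := hr
    exact ⟨algebraMap F K a, by rw [← map_pow, ← map_mul, ← map_sub, ← map_add, ha, map_zero]⟩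
  push Not at hr
  -- Without a root in `F` the quadratic is irreducible, and its root field, of degree 2, embeds
  -- into `K`.
  set p : F[X] := X ^ 2 - C t * X + C d with hp
  have hdeg : p.natDegree = 2 := by rw [hp]; compute_degree!
  have hirr : Irreducible p := irreducible_of_degree_le_three_of_not_isRoot
    (by rw [hdeg]; decide) fun a ha => hr a (by simpa [hp, IsRoot] using ha)
  have := Fact.mk hirr
  have hfr : Module.finrank F (AdjoinRoot p) = 2 := by
    rw [(AdjoinRoot.powerBasis hirr.ne_zero).finrank, AdjoinRoot.powerBasis_dim, hdeg]
  obtain ⟨φ⟩ := FiniteField.nonempty_algHom_of_finrank_dvd (F := F) (K := AdjoinRoot p) (L := K)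
    (by rw [hfr, hK])
  refine ⟨φ (AdjoinRoot.root p), ?_⟩
  have h := congrArg φ (AdjoinRoot.aeval_eq p (f := p) ▸ AdjoinRoot.mk_self)
  simpa [hp, ← AdjoinRoot.algebraMap_eq] using h

/-- Frobenius fixes the coefficients, so `z ^ q` is a second root, distinct from `z`; these are
Vieta's formulas. -/
theorem pow_root_quadratic [Finite F] [Finite K] {t d : F} {z : K}
    (hz : z ^ 2 - algebraMap F K t * z + algebraMap F K d = 0) (hzF : z ∉ (algebraMap F K).range) :
    algebraMap F K t = z + z ^ Nat.card F ∧ algebraMap F K d = z * z ^ Nat.card F := by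
  have hfix : ∀ a : F, algebraMap F K a ^ Nat.card F = algebraMap F K a := fun a =>
    (pow_natCard_eq_self_iff _).2 ⟨a, rfl⟩
  have hz' : (z ^ Nat.card F) ^ 2 - algebraMap F K t * z ^ Nat.card F + algebraMap F K d = 0 := by
    have h1 : z ^ 2 + algebraMap F K d = algebraMap F K t * z := by linear_combination hz
    have h2 := congrArg (· ^ Nat.card F) h1
    simp only [add_pow_natCard, mul_pow, hfix] at h2
    rw [← pow_mul, mul_comm, pow_mul] at h2
    linear_combination h2
  have hne : z ^ Nat.card F - z ≠ 0 :=
    sub_ne_zero.2 fun h => hzF ((pow_natCard_eq_self_iff _).1 h)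
  have ht : algebraMap F K t = z + z ^ Nat.card F := by
    refine mul_left_cancel₀ hne ?_
    linear_combination hz - hz'
  exact ⟨ht, by rw [ht] at hz; linear_combination hz⟩

open Classical in
/-- Summation over the quadratic polynomials `X² - tX + d` with `d ≠ 0` by way of their roots. -/
theorem two_mul_sum_quadratic [Fintype F] [Fintype K] (hK : Module.finrank F K = 2)
    (f : F × Fˣ → ℂ) (g : Kˣ → ℂ)
    (hsplit : ∀ a b : Fˣ, a ≠ b → f (a + b, a * b) = 0)
    (hdouble : ∀ a : Fˣ, f (a + a, a * a) = 1)
    (hnonsplit : ∀ z : Kˣ, (z : K) ∉ (algebraMap F K).range → ∀ (t : F) (d : Fˣ),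
      algebraMap F K t = z + z ^ Nat.card F → algebraMap F K d = z * z ^ Nat.card F →
      f (t, d) = g z) :
    2 * ∑ p, f p = 2 * (Fintype.card Fˣ : ℂ) +
      ∑ z ∈ Finset.univ.filter (fun z : Kˣ => (z : K) ∉ (algebraMap F K).range), g z := by
  have inj := FaithfulSMul.algebraMap_injective F K
  -- Both sides are compared polynomial by polynomial: a double root appears once in the first sum,
  -- an irreducible polynomial twice in the second (through `z` and `z ^ q`), a split one in
  -- neither. Exchanging summations then finishes.
  have key : ∀ p : F × Fˣ, 2 * f p = 2 * (∑ a : Fˣ, if p = ((a : F) + a, a * a) then 1 else 0) +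
      ∑ z ∈ Finset.univ.filter (fun z : Kˣ => (z : K) ∉ (algebraMap F K).range),
        if (z : K) ^ 2 - algebraMap F K p.1 * z + algebraMap F K p.2 = 0 then g z else 0 := by
    rintro ⟨t, d⟩
    obtain ⟨z₀, hz₀⟩ := exists_root_quadratic hK t (d : F)
    have hz0 : z₀ ≠ 0 := by
      rintro rfl
      apply d.ne_zero
      apply inj
      simpa only [ne_eq, OfNat.ofNat_ne_zero, not_false_eq_true, zero_pow, mul_zero, sub_self,
        zero_add, map_zero] using hz₀
    obtain ⟨z, rfl⟩ : ∃ z : Kˣ, (z : K) = z₀ := ⟨Units.mk0 z₀ hz0, rfl⟩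
    by_cases hzF : (z : K) ∈ (algebraMap F K).range
    · obtain ⟨a, ha⟩ := hzF
      have had : a * (t - a) = d := by
        apply inj
        rw [map_mul, map_sub, ha]
        linear_combination -hz₀
      have ha0 : a ≠ 0 := by
        rintro rfl
        exact d.ne_zero (by rw [← had, zero_mul])
      have hb0 : t - a ≠ 0 := by
        intro h
        exact d.ne_zero (by rw [← had, h, mul_zero])
      lift a to Fˣ using ha0.isUnit
      obtain ⟨b, hb⟩ : ∃ b : Fˣ, (b : F) = t - a := ⟨Units.mk0 _ hb0, rfl⟩
      obtain rfl : t = a + b := by rw [hb]; ring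
      obtain rfl : d = a * b := by ext; rw [← had]; simp
      rw [Finset.sum_eq_zero (s := Finset.univ.filter _)]
      · by_cases hab : a = b
        · subst hab
          rw [hdouble, Finset.sum_eq_single a]
          · simp
          · intro c _ hc
            rw [if_neg]
            intro h
            simp only [Prod.mk.injEq, Units.ext_iff, Units.val_mul] at h
            apply hc
            ext
            -- Squaring avoids dividing the trace equation by 2, so characteristic 2 is covered.
            have : ((c : F) - a) ^ 2 = 0 := by linear_combination -h.2 + (a : F) * h.1
            exact sub_eq_zero.1 (pow_eq_zero_iff two_ne_zero |>.1 this)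
          · simp
        · rw [hsplit a b hab, Finset.sum_eq_zero]
          · simp
          · intro c _
            rw [if_neg]
            intro h
            simp only [Prod.mk.injEq, Units.ext_iff, Units.val_mul] at h
            apply hab
            ext
            have h1 : ((a : F) - c) ^ 2 = 0 := by linear_combination -h.2 + (a : F) * h.1
            have h2 := sub_eq_zero.1 (pow_eq_zero_iff two_ne_zero |>.1 h1)
            linear_combination 2 * h2 - h.1
      · intro w hw
        have hwF := (Finset.mem_filter.1 hw).2
        rw [if_neg]
        intro h
        have h3 : ((w : K) - algebraMap F K a) * (w - algebraMap F K b) = 0 := by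
          rw [← h]
          simp only [map_add, Units.val_mul, map_mul]
          ring
        rcases mul_eq_zero.1 h3 with h | h
        · exact hwF ⟨a, (sub_eq_zero.1 h).symm⟩
        · exact hwF ⟨b, (sub_eq_zero.1 h).symm⟩
    · obtain ⟨ht, hd⟩ := pow_root_quadratic hz₀ hzF
      have hw : (z : K) ^ Nat.card F ∉ (algebraMap F K).range := by
        intro h
        apply hzF
        rw [← pow_natCard_eq_self_iff, pow_natCard_sq hK] at h
        exact (pow_natCard_eq_self_iff _).1 h.symm
      have hne : z ≠ z ^ Nat.card F := by
        intro h
        refine hzF ((pow_natCard_eq_self_iff _).1 ?_)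
        rw [← Units.val_pow_eq_pow_val, ← h]
      rw [Finset.sum_eq_zero (s := (Finset.univ : Finset Fˣ)), ← Finset.sum_filter,
        show (Finset.univ.filter _).filter _ = ({z, z ^ Nat.card F} : Finset Kˣ) from ?_,
        Finset.sum_pair hne, ← hnonsplit z hzF t d ht hd,
        ← hnonsplit (z ^ Nat.card F) (by simpa using hw) t d
          (by rw [Units.val_pow_eq_pow_val, pow_natCard_sq hK, ht, add_comm])
          (by rw [Units.val_pow_eq_pow_val, pow_natCard_sq hK, hd, mul_comm])]
      · ring
      · ext w
        simp only [Finset.mem_filter, Finset.mem_univ, true_and, Finset.mem_insert,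
          Finset.mem_singleton, Units.ext_iff, Units.val_pow_eq_pow_val, ht, hd]
        have e : (w : K) ^ 2 - (z + z ^ Nat.card F) * w + z * z ^ Nat.card F =
          (w - z) * (w - z ^ Nat.card F) := by ring
        rw [e, mul_eq_zero, sub_eq_zero, sub_eq_zero]
        constructor
        · exact fun h => h.2
        · rintro (h | h)
          · exact ⟨by rwa [h], Or.inl h⟩
          · exact ⟨by rwa [h], Or.inr h⟩
      · intro a _
        rw [if_neg]
        intro h
        simp only [Prod.mk.injEq] at h
        rw [h.1, h.2] at hz₀
        have h3 : ((z : K) - algebraMap F K a) ^ 2 = 0 := by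
          rw [← hz₀]
          simp only [map_add, Units.val_mul, map_mul]
          ring
        exact hzF ⟨a, (sub_eq_zero.1 (pow_eq_zero_iff two_ne_zero |>.1 h3)).symm⟩
  rw [Finset.mul_sum, Finset.sum_congr rfl fun p _ => key p, Finset.sum_add_distrib,
    ← Finset.mul_sum, Finset.sum_comm]
  congr 1
  · simp
  · rw [Finset.sum_comm]
    refine Finset.sum_congr rfl fun z hz => ?_
    have hzF := (Finset.mem_filter.1 hz).2
    obtain ⟨t, ht⟩ := exists_trace hK (z : K)
    obtain ⟨d, hd⟩ := exists_norm hK z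
    rw [Finset.sum_eq_single (t, d)]
    · rw [if_pos]
      rw [ht, hd]
      ring
    · rintro ⟨t', d'⟩ _ hne
      rw [if_neg]
      intro h
      obtain ⟨ht', hd'⟩ := pow_root_quadratic h hzF
      apply hne
      rw [Prod.mk.injEq, Units.ext_iff]
      exact ⟨inj (ht'.trans ht.symm), inj (hd'.trans hd.symm)⟩
    · simp

open Classical in
/-- The sum over `K ∖ F` of the squared absolute values of `φ(z) + φ(z^q)`. -/
theorem sum_nonsplit [Fintype F] [Fintype K] (hK : Module.finrank F K = 2) (φ : Kˣ →* ℂˣ)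
    (hφ : ∃ z : Kˣ, φ (z ^ Nat.card F) ≠ φ z) :
    ∑ z ∈ Finset.univ.filter (fun z : Kˣ => (z : K) ∉ (algebraMap F K).range),
      ((φ z : ℂ) + φ (z ^ Nat.card F)) * (φ z⁻¹ + φ (z⁻¹ ^ Nat.card F)) =
      2 * ((Nat.card F : ℂ) - 1) ^ 2 := by
  -- With `ψ(z) = φ(z ^ q)/φ(z)` the summand is `2 + ψ + ψ⁻¹`. As `ψ ≠ 1`, the sum over `Kˣ` is
  -- `2(q²-1)`; on `Fˣ` one has `ψ = 1`, so `4(q-1)` is removed.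
  let ψ : Kˣ →* ℂˣ := (φ.comp (powMonoidHom (Nat.card F))) * φ⁻¹
  let ψ' : Kˣ →* ℂ := (Units.coeHom ℂ).comp ψ
  let ψ'' : Kˣ →* ℂ := (Units.coeHom ℂ).comp ψ⁻¹
  have hψ : ψ ≠ 1 := by
    obtain ⟨z, hz⟩ := hφ
    intro h
    apply hz
    have := DFunLike.congr_fun h z
    simpa [ψ, mul_inv_eq_one] using this
  have h1 : ∑ z, ψ' z = 0 := sum_hom_units_eq_zero _ fun h => hψ (by
    ext z
    simpa [ψ'] using DFunLike.congr_fun h z)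
  have h2 : ∑ z, ψ'' z = 0 := sum_hom_units_eq_zero _ fun h => hψ (by
    ext z
    have := DFunLike.congr_fun h z
    simpa [ψ''] using this)
  have hg : ∀ z : Kˣ, ((φ z : ℂ) + φ (z ^ Nat.card F)) * (φ z⁻¹ + φ (z⁻¹ ^ Nat.card F)) =
      2 + ψ' z + ψ'' z := by
    intro z
    have e1 : ((φ z : ℂˣ) : ℂ) ≠ 0 := (φ z).ne_zero
    simp [ψ', ψ'', ψ]
    field_simp
    ring
  have hFK : Fintype.card K = Nat.card F ^ 2 := by
    rw [← Nat.card_eq_fintype_card, Module.natCard_eq_pow_finrank (K := F), hK]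
  have hcK : (Fintype.card Kˣ : ℂ) = (Nat.card F : ℂ) ^ 2 - 1 := by
    rw [Fintype.card_units, hFK, Nat.cast_sub (Nat.one_le_pow _ _ Nat.card_pos)]
    simp
  have hcF : (Fintype.card Fˣ : ℂ) = (Nat.card F : ℂ) - 1 := by
    rw [Fintype.card_units, ← Nat.card_eq_fintype_card, Nat.cast_sub Nat.card_pos]
    simp
  have hall : ∑ z : Kˣ, (2 + ψ' z + ψ'' z) = 2 * ((Nat.card F : ℂ) ^ 2 - 1) := by
    rw [Finset.sum_add_distrib, Finset.sum_add_distrib, h1, h2]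
    simp [hcK, mul_comm]
  have hin : ∑ z ∈ Finset.univ.filter (fun z : Kˣ => (z : K) ∈ (algebraMap F K).range),
      (2 + ψ' z + ψ'' z) =
      4 * ((Nat.card F : ℂ) - 1) := by
    have : ∀ z ∈ Finset.univ.filter fun z : Kˣ => (z : K) ∈ (algebraMap F K).range,
        (2 + ψ' z + ψ'' z) = 4 := by
      intro z hz
      have hz := (pow_natCard_eq_self_iff _).2 (Finset.mem_filter.1 hz).2
      have hz' : z ^ Nat.card F = z := Units.ext (by simpa using hz)
      have : ψ z = 1 := by
        simp only [ψ, MonoidHom.mul_apply, MonoidHom.comp_apply, powMonoidHom_apply, hz',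
          MonoidHom.inv_apply, mul_inv_cancel]
      simp [ψ', ψ'', this]
      norm_num
    rw [Finset.sum_congr rfl this, Finset.sum_const, nsmul_eq_mul, mul_comm, ← hcF]
    congr 2
    rw [← Finset.card_univ]
    symm
    refine Finset.card_bij (fun a _ => Units.map (algebraMap F K).toMonoidHom a) ?_ ?_ ?_
    · intro a _
      simp
    · intro a _ b _ h
      exact Units.map_injective (FaithfulSMul.algebraMap_injective F K) h
    · intro z hz
      obtain ⟨a, ha⟩ := (Finset.mem_filter.1 hz).2
      refine ⟨Units.mk0 a ?_, Finset.mem_univ _, Units.ext ha⟩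
      rintro rfl
      exact z.ne_zero (by rw [← ha, map_zero])
  rw [Finset.sum_congr rfl fun z _ => hg z]
  have hs := Finset.sum_filter_add_sum_filter_not Finset.univ
    (fun z : Kˣ => (z : K) ∈ (algebraMap F K).range) (fun z => 2 + ψ' z + ψ'' z)
  rw [hin, hall] at hs
  have hs' : ∑ z ∈ Finset.univ.filter (fun z : Kˣ => (z : K) ∉ (algebraMap F K).range),
      (2 + ψ' z + ψ'' z) =
      2 * ((Nat.card F : ℂ) ^ 2 - 1) - 4 * ((Nat.card F : ℂ) - 1) := by
    rw [← hs, add_sub_cancel_left]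
  rw [hs']
  ring

theorem fieldChar_generator [Finite K] (σ : Kˣ) (hσ : ∀ x : Kˣ, x ∈ Subgroup.zpowers σ) (n : ℤ) :
    (fieldChar σ hσ n σ : ℂ) = Complex.exp (2 * Real.pi * Complex.I * n / Nat.card Kˣ) := by
  rw [fieldChar, monoidHomOfForallMemZpowers_apply_gen]
  rfl

/-- Equality would give `(q-1)n = m(q²-1)` for some integer `m`, hence `q+1 ∣ n`. This supplies the
nontriviality needed in `sum_nonsplit`. -/
theorem fieldChar_pow_ne [Finite F] [Finite K] (hK : Module.finrank F K = 2) (σ : Kˣ)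
    (hσ : ∀ x : Kˣ, x ∈ Subgroup.zpowers σ) (n : ℤ) (hn : ¬ ((Nat.card F : ℤ) + 1 ∣ n)) :
    fieldChar σ hσ n (σ ^ Nat.card F) ≠ fieldChar σ hσ n σ := by
  intro h
  have := Fintype.ofFinite K
  have hF : 1 < Nat.card F := Finite.one_lt_card
  have hcK : (Nat.card Kˣ : ℤ) = ((Nat.card F : ℤ) - 1) * (Nat.card F + 1) := by
    rw [Nat.card_units, Module.natCard_eq_pow_finrank (K := F), hK,
      Nat.cast_sub (Nat.one_le_pow _ _ Nat.card_pos)]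
    push_cast
    ring
  have hcK' : (Nat.card Kˣ : ℂ) = ((Nat.card F : ℂ) - 1) * (Nat.card F + 1) := by
    exact_mod_cast hcK
  have h0 : (Nat.card Kˣ : ℂ) ≠ 0 := Nat.cast_ne_zero.2 Nat.card_pos.ne'
  have h' := congrArg (Units.val) h
  rw [map_pow, Units.val_pow_eq_pow_val, fieldChar_generator, ← Complex.exp_nat_mul,
    Complex.exp_eq_exp_iff_exists_int] at h'
  obtain ⟨m, hm⟩ := h'
  have hpi : (2 * Real.pi * Complex.I : ℂ) ≠ 0 := Complex.two_pi_I_ne_zero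
  have h1 : ((Nat.card F : ℂ) - 1) * n = m * Nat.card Kˣ := by
    field_simp at hm
    linear_combination hm
  have h2 : ((Nat.card F : ℤ) - 1) * n = m * Nat.card Kˣ := by exact_mod_cast h1
  rw [hcK] at h2
  apply hn
  refine ⟨m, mul_left_cancel₀ (a := (Nat.card F : ℤ) - 1) (by omega) ?_⟩
  rw [h2]
  ring

end QuadraticExtension

/-! ### Values of the character of `X_[n]` on the classes -/

section CuspidalCharacter

theorem Representation.character_eq_of_isConj {G W : Type*} [Group G] [AddCommGroup W] [Module ℂ W]
    (π : Representation ℂ G W) {g h : G} (H : IsConj g h) : π.character g = π.character h := by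
  obtain ⟨c, rfl⟩ := isConj_iff.1 H
  exact (π.char_conj g c).symm

theorem isConj_inv_inv {G : Type*} [Group G] {g h : G} (H : IsConj g h) : IsConj g⁻¹ h⁻¹ := by
  obtain ⟨c, rfl⟩ := isConj_iff.1 H
  exact isConj_iff.2 ⟨c, by group⟩

theorem lowerGL_inv {L : Type*} [Field L] (a b : Lˣ) (c : L) :
    (lowerGL a b c)⁻¹ = lowerGL a⁻¹ b⁻¹ (-(a⁻¹ * b⁻¹ : Lˣ) * c) := by
  rw [inv_eq_iff_mul_eq_one]
  ext i j
  fin_cases i <;> fin_cases j <;>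
    simp [Matrix.mul_apply, Fin.sum_univ_two, coe_lowerGL]
  field_simp
  ring

theorem map_companionGL {F K : Type*} [Field F] [Field K] [Algebra F K] (t : F) (d : Fˣ) :
    Matrix.GeneralLinearGroup.map (algebraMap F K) (companionGL t d) =
      companionGL (algebraMap F K t) (Units.map (algebraMap F K).toMonoidHom d) := by
  ext i j
  fin_cases i <;> fin_cases j <;> simp [coe_companionGL]

variable {F K : Type*} [Field F] [Finite F] [Field K] [Finite K] [Algebra F K]
  {σ : Kˣ} {hσ : ∀ x : Kˣ, x ∈ Subgroup.zpowers σ} {n : ℤ}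
  {W : Type*} [AddCommGroup W] [Module ℂ W] {π : Representation ℂ (GL (Fin 2) F) W}

namespace IsTypeX

theorem character_mul_inv_scalar (hπ : IsTypeX σ hσ n π) (a : Fˣ) :
    π.character (lowerGL a a 0) * π.character (lowerGL a a 0)⁻¹ = ((Nat.card F : ℂ) - 1) ^ 2 := by
  have h0 : (fieldChar σ hσ n (Units.map (algebraMap F K).toMonoidHom a) : ℂ) ≠ 0 :=
    Units.ne_zero _
  rw [lowerGL_inv, mul_zero, hπ.scalar, hπ.scalar, map_inv, map_inv, Units.val_inv_eq_inv_val]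
  field_simp

theorem character_companionGL_split (hπ : IsTypeX σ hσ n π) {a b : Fˣ} (hab : a ≠ b) :
    π.character (companionGL (a + b : F) (a * b)) = 0 := by
  rw [π.character_eq_of_isConj (isConj_companionGL_lowerGL a b 0 (Or.inl hab)), hπ.split a b hab]

theorem character_mul_inv_double (hπ : IsTypeX σ hσ n π) (a : Fˣ) :
    π.character (companionGL (a + a : F) (a * a)) *
      π.character (companionGL (a + a : F) (a * a))⁻¹ = 1 := by
  have h0 : (fieldChar σ hσ n (Units.map (algebraMap F K).toMonoidHom a) : ℂ) ≠ 0 :=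
    Units.ne_zero _
  have h := isConj_companionGL_lowerGL a a 1 (Or.inr one_ne_zero)
  have h' := isConj_inv_inv h
  rw [lowerGL_inv] at h'
  -- The inverse has lower-left entry `-a⁻²` rather than 1; both matrices are conjugate to the same
  -- companion matrix.
  have h₁ := isConj_companionGL_lowerGL a⁻¹ a⁻¹ (-(a⁻¹ * a⁻¹ : Fˣ) * 1) (Or.inr (by simp))
  have h₂ := isConj_companionGL_lowerGL a⁻¹ a⁻¹ 1 (Or.inr one_ne_zero)
  rw [π.character_eq_of_isConj h, π.character_eq_of_isConj (h'.trans (h₁.symm.trans h₂)),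
    hπ.unipotent, hπ.unipotent, map_inv, map_inv, Units.val_inv_eq_inv_val]
  field_simp

theorem character_mul_inv_nonsplit (hπ : IsTypeX σ hσ n π) {z : Kˣ}
    (hz : (z : K) ∉ (algebraMap F K).range)
    {t : F} {d : Fˣ} (ht : algebraMap F K t = z + z ^ Nat.card F)
    (hd : algebraMap F K d = z * z ^ Nat.card F) :
    π.character (companionGL t d) * π.character (companionGL t d)⁻¹ =
      ((fieldChar σ hσ n z : ℂ) + fieldChar σ hσ n (z ^ Nat.card F)) *
        (fieldChar σ hσ n z⁻¹ + fieldChar σ hσ n (z⁻¹ ^ Nat.card F)) := by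
  have hne : z ≠ z ^ Nat.card F := by
    intro h
    refine hz ((pow_natCard_eq_self_iff _).1 ?_)
    rw [← Units.val_pow_eq_pow_val, ← h]
  have hd' : Units.map (algebraMap F K).toMonoidHom d = z * z ^ Nat.card F :=
    Units.ext (by simpa using hd)
  have h := isConj_companionGL_lowerGL z (z ^ Nat.card F) 0 (Or.inl hne)
  rw [Units.val_pow_eq_pow_val, ← ht, ← hd', ← map_companionGL] at h
  have h' := isConj_inv_inv h
  rw [← map_inv, lowerGL_inv, mul_zero, ← inv_pow] at h'
  have hz' : ((z⁻¹ : Kˣ) : K) ∉ (algebraMap F K).range := by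
    rintro ⟨a, ha⟩
    exact hz ⟨a⁻¹, by rw [map_inv₀, ha, Units.val_inv_eq_inv_val, inv_inv]⟩
  rw [hπ.nonsplit _ z hz h, hπ.nonsplit _ z⁻¹ hz' h', neg_mul_neg]

theorem finrank_sphericalFunctions (hπ : IsTypeX σ hσ n π) [FiniteDimensional ℂ W]
    (hK : Module.finrank F K = 2) :
    (Module.finrank ℂ (sphericalFunctions (diagSubgroup (GL (Fin 2) F)) (diagRep π)) : ℂ) =
      ((Nat.card F : ℂ) - 1) * ((Nat.card F : ℂ) ^ 2 - Nat.card F + 1) := by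
  classical
  have := Fintype.ofFinite F
  have := Fintype.ofFinite K
  have := Fintype.ofFinite (ConjClasses (GL (Fin 2) F))
  have hcF : (Fintype.card Fˣ : ℂ) = (Nat.card F : ℂ) - 1 := by
    rw [Fintype.card_units, ← Nat.card_eq_fintype_card, Nat.cast_sub Nat.card_pos]
    simp
  let f : ConjClasses (GL (Fin 2) F) → ℂ :=
    Quotient.lift (fun g => π.character g * π.character g⁻¹) fun a b hab => by
      have hab : IsConj a b := hab
      rw [π.character_eq_of_isConj hab, π.character_eq_of_isConj (isConj_inv_inv hab)]
  rw [finrank_sphericalFunctions_diagSubgroup π f fun _ => rfl,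
    ← conjClassesGL2Equiv.sum_comp, Fintype.sum_sum_type]
  have h1 : ∑ a : Fˣ, f (conjClassesGL2Equiv (Sum.inl a)) =
      ((Nat.card F : ℂ) - 1) * ((Nat.card F : ℂ) - 1) ^ 2 := by
    refine (Finset.sum_congr rfl fun a _ => hπ.character_mul_inv_scalar a).trans ?_
    simp [hcF]
  have h2 := two_mul_sum_quadratic hK (fun p => f (conjClassesGL2Equiv (Sum.inr p)))
    (fun z => ((fieldChar σ hσ n z : ℂ) + fieldChar σ hσ n (z ^ Nat.card F)) *
        (fieldChar σ hσ n z⁻¹ + fieldChar σ hσ n (z⁻¹ ^ Nat.card F)))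
    (fun a b hab => by
      change π.character (companionGL _ _) * _ = 0
      rw [hπ.character_companionGL_split hab, zero_mul])
    (fun a => hπ.character_mul_inv_double a)
    (fun z hz t d ht hd => hπ.character_mul_inv_nonsplit hz ht hd)
  rw [sum_nonsplit hK _ ⟨σ, fieldChar_pow_ne hK σ hσ n hπ.index⟩, hcF] at h2
  rw [h1]
  linear_combination h2 / 2

end IsTypeX

theorem card_conjClasses_GL2 (F : Type*) [Field F] [Finite F] :
    (Nat.card (ConjClasses (GL (Fin 2) F)) : ℤ) = (Nat.card F : ℤ) ^ 2 - 1 := by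
  rw [← Nat.card_congr conjClassesGL2Equiv, Nat.card_sum, Nat.card_prod, Nat.card_units]
  push_cast [Nat.cast_sub (Nat.card_pos (α := F))]
  ring

end CuspidalCharacter

/-! ### Dimensions, non-divisibility and non-freeness -/

theorem mainTheorem4 {F K : Type*} [Field F] [Finite F] [Field K] [Finite K] [Algebra F K]
    (hK : Module.finrank F K = 2) (q : ℕ) (hq : Nat.card F = q)
    (σ : Kˣ) (hσ : ∀ x : Kˣ, x ∈ Subgroup.zpowers σ) (n : ℤ)
    {W : Type*} [AddCommGroup W] [Module ℂ W] [FiniteDimensional ℂ W]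
    (π : Representation ℂ (GL (Fin 2) F) W) (hπ : IsTypeX σ hσ n π) :
    (Module.finrank ℂ (sphericalFunctions (diagSubgroup (GL (Fin 2) F)) (diagRep π)) : ℤ)
        = ((q : ℤ) - 1) * ((q : ℤ) ^ 2 - q + 1) ∧
    (Module.finrank ℂ (zonalAlgebra (diagSubgroup (GL (Fin 2) F))) : ℤ) = (q : ℤ) ^ 2 - 1 ∧
    (q ≠ 2 →
      ¬ (Module.finrank ℂ (zonalAlgebra (diagSubgroup (GL (Fin 2) F))) ∣
          Module.finrank ℂ (sphericalFunctions (diagSubgroup (GL (Fin 2) F)) (diagRep π))) ∧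
      ¬ Module.Free (zonalAlgebra (diagSubgroup (GL (Fin 2) F)))
          (sphericalFunctions (diagSubgroup (GL (Fin 2) F)) (diagRep π))) := by
  subst hq
  have hX : (Module.finrank ℂ (sphericalFunctions (diagSubgroup (GL (Fin 2) F)) (diagRep π)) : ℤ)
      = ((Nat.card F : ℤ) - 1) * ((Nat.card F : ℤ) ^ 2 - Nat.card F + 1) := by
    exact_mod_cast hπ.finrank_sphericalFunctions hK
  have hU : (Module.finrank ℂ (zonalAlgebra (diagSubgroup (GL (Fin 2) F))) : ℤ) =
      (Nat.card F : ℤ) ^ 2 - 1 := by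
    rw [finrank_zonalAlgebra_diagSubgroup, card_conjClasses_GL2]
  refine ⟨hX, hU, fun h2 => ?_⟩
  have hF : 1 < Nat.card F := Finite.one_lt_card
  have hndvd : ¬ (Module.finrank ℂ (zonalAlgebra (diagSubgroup (GL (Fin 2) F))) ∣
      Module.finrank ℂ (sphericalFunctions (diagSubgroup (GL (Fin 2) F)) (diagRep π))) := by
    rw [← Int.natCast_dvd_natCast, hX, hU]
    rintro ⟨m, hm⟩
    have h3 : (Nat.card F : ℤ) ^ 2 - Nat.card F + 1 = (Nat.card F + 1) * m :=
      mul_left_cancel₀ (a := (Nat.card F : ℤ) - 1) (by omega) (by rw [hm]; ring)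
    -- Division with remainder: `q² - q + 1 = (q + 1)(q - 2) + 3`.
    have h4 : ((Nat.card F : ℤ) + 1) ∣ 3 := ⟨m - (Nat.card F - 2), by linear_combination h3⟩
    have h5 := Int.le_of_dvd (by norm_num) h4
    omega
  -- For a free module, the dimension over `ℂ` is `dim E(U₀)` times the rank.
  refine ⟨hndvd, fun hfree => hndvd ⟨_, (Module.finrank_mul_finrank ℂ
    (zonalAlgebra (diagSubgroup (GL (Fin 2) F))) _).symm⟩⟩
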